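/- For subgroups $X,Y$ of a group write $[X,Y]$ for the subgroup generated by all commutators $[x,y]$, $x\in X$, $y\in Y$, and write $X'=[X,X]$. For a prime $p$, a finite $p$-group is *extra-special* if its derived group and its centre coincide and have order $p$. An infinite group is *just infinite* if all its proper quotients are finite, and *hereditarily just infinite* if it is infinite and all its subgroups of finite index are just infinite. Let $p_1,p_2,\dots$ be an infinite sequence of primes with $p_{i+1}\ne p_i$ for all $i\ge 1$, and for each $i\ge2$ let $M_i$ be an extra-special group of order $p_i^3$. Define groups $G_i$ with normal subgroups $R_i$ inductively as follows. Let $G_1=R_1$ be the cyclic group of order $p_1$. For $i\ge2$ let $H=M_i\wr G_{i-1}$ be the regular wreath product, with base group $B$; put $B_i=B/[B',H]$ (here $[B',H]=[B',G_{i-1}]$), on which $G_{i-1}$ acts naturally; let $D_i=[B_i,R_{i-1}]$, computed in $H/[B',H]$, which is normalized by $G_{i-1}$; let $G_i=D_i\rtimes G_{i-1}$ be the semidirect product with the induced action, and let $R_i=D_i'$. Regard $G_{i-1}$ as a subgroup of $G_i$ and let $G=\bigcup_i G_i$ be the direct limit of $G_1\le G_2\le\cdots$. **Theorem.** 1. For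 every such choice of primes $p_i$ and groups $M_i$, every $G_i$ is a finite soluble group, and $R_i$ is its unique minimal normal subgroup, is central in $G_i$ and has order $p_i$; moreover $G$ is hereditarily just infinite, residually finite, periodic and locally soluble (every finitely generated subgroup is soluble). 2. Groups $G$ obtained from different sequences of primes (whatever the choices of the $M_i$) are not isomorphic, and the family of all groups $G$ so obtained is uncountable up to isomorphism, that is, no countable list of groups contains an isomorphic copy of each of them. -/

import Mathlib

/-- A finite `p`-group is extra-special if its derived group and its centre coincide and have
order `p`. -/
structure IsExtraspecial (p : ℕ) (M : Type*) [Group M] : Prop where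
  finite : Finite M
  isPGroup : IsPGroup p M
  commutator_eq_center : commutator M = Subgroup.center M
  card_center : Nat.card (Subgroup.center M) = p

/-- An infinite group all of whose proper quotients are finite. -/
def IsJustInfinite (G : Type*) [Group G] : Prop :=
  Infinite G ∧ ∀ N : Subgroup G, N.Normal → N ≠ ⊥ → Finite (G ⧸ N)

/-- An infinite group all of whose subgroups of finite index are just infinite
(residual finiteness is not part of this definition). -/
def IsHereditarilyJustInfinite (G : Type*) [Group G] : Prop :=
  Infinite G ∧ ∀ H : Subgroup G, H.FiniteIndex → IsJustInfinite H

/-- A group all of whose finitely generated subgroups are soluble. -/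
def IsLocallySoluble (G : Type*) [Group G] : Prop :=
  ∀ H : Subgroup G, H.FG → Group.IsSolvable H

namespace WreathTower

section Step

open RegularWreathProduct

variable (M K : Type) [Group M] [Group K]

/-- The base group `B` of the wreath product `H = M ≀ K`. -/
def base : Subgroup (M ≀ᵣ K) := (rightHom : M ≀ᵣ K →* K).ker

instance : (base M K).Normal := by unfold base; infer_instance

/-- The subgroup `[B', H]`. If `M` is extra-special then `B'` is central in `B`, so that this
is also `[B', K]`. -/
def killed : Subgroup (M ≀ᵣ K) := ⁅⁅base M K, base M K⁆, (⊤ : Subgroup (M ≀ᵣ K))⁆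

instance : (killed M K).Normal := by unfold killed; infer_instance

/-- The group `H / [B', H]`. -/
abbrev WreathQuotient : Type := (M ≀ᵣ K) ⧸ killed M K

/-- The image `B / [B', H]` of the base group in `H / [B', H]`. -/
def baseQuotient : Subgroup (WreathQuotient M K) :=
  (base M K).map (QuotientGroup.mk' (killed M K))

instance : (baseQuotient M K).Normal :=
  Subgroup.Normal.map inferInstance _ (QuotientGroup.mk'_surjective _)

/-- The canonical map from the top group `K` to `H / [B', H]`. -/
def topHom : K →* WreathQuotient M K := (QuotientGroup.mk' (killed M K)).comp inl

variable {K}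

/-- The subgroup `D = [B / [B', H], R]` for a subgroup `R` of `K`. -/
def kernelD (R : Subgroup K) : Subgroup (WreathQuotient M K) :=
  ⁅baseQuotient M K, R.map (topHom M K)⁆

/-- Every element of `H / [B', H]` is a product of an element of the image of `B` and an
element of the image of `K`. -/
theorem exists_base_mul_top (x : WreathQuotient M K) :
    ∃ b ∈ baseQuotient M K, ∃ k : K, b * topHom M K k = x := by
  obtain ⟨y, rfl⟩ := QuotientGroup.mk'_surjective (killed M K) x
  refine ⟨QuotientGroup.mk' _ (y * (inl y.right)⁻¹), Subgroup.mem_map_of_mem _ ?_, y.right, ?_⟩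
  · change rightHom (y * (inl y.right)⁻¹) = 1
    simp
  · simp [topHom]

instance kernelD_normal (R : Subgroup K) [hR : R.Normal] : (kernelD M R).Normal := by
  refine Subgroup.normalizer_eq_top_iff.mp (top_le_iff.mp fun x _ => ?_)
  obtain ⟨b, hb, k, rfl⟩ := exists_base_mul_top M x
  refine mul_mem (Subgroup.normalizer_commutator_ge_left _ _ hb) ?_
  have key : ∀ k : K, ∀ d ∈ kernelD M R,
      topHom M K k * d * (topHom M K k)⁻¹ ∈ kernelD M R := by
    intro k d hd
    have h : (kernelD M R).map (MulAut.conj (topHom M K k)).toMonoidHom ≤ kernelD M R := by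
      unfold kernelD
      rw [Subgroup.map_commutator]
      refine Subgroup.commutator_mono ?_ ?_
      · rintro _ ⟨c, hc, rfl⟩
        exact Subgroup.Normal.conj_mem inferInstance c hc _
      · rintro _ ⟨_, ⟨r, hr, rfl⟩, rfl⟩
        exact ⟨k * r * k⁻¹, hR.conj_mem r hr k, by simp⟩
    exact h ⟨d, hd, rfl⟩
  rw [Subgroup.mem_normalizer_iff]
  refine fun d => ⟨key k d, fun hd => ?_⟩
  simpa [mul_assoc] using key k⁻¹ _ hd

/-- The action of `K` on `D` induced by its action on the base group. -/
def actD (R : Subgroup K) [R.Normal] : K →* MulAut (kernelD M R) :=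
  MulAut.conjNormal.comp (topHom M K)

/-- The semidirect product of `D` by `K`. -/
abbrev Next (R : Subgroup K) [R.Normal] : Type := kernelD M R ⋊[actD M R] K

/-- The subgroup `D'` of the semidirect product of `D` by `K`. -/
def nextR (R : Subgroup K) [R.Normal] : Subgroup (Next M R) :=
  (commutator (kernelD M R)).map SemidirectProduct.inl

instance nextR_normal (R : Subgroup K) [R.Normal] : (nextR M R).Normal := by
  have h : nextR M R = ⁅(SemidirectProduct.rightHom : Next M R →* K).ker,
      (SemidirectProduct.rightHom : Next M R →* K).ker⁆ := by
    rw [nextR, commutator_def, Subgroup.map_commutator, ← MonoidHom.range_eq_map,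
      SemidirectProduct.range_inl_eq_ker_rightHom]
  rw [h]
  infer_instance

end Step

/-- A group with a distinguished normal subgroup. -/
structure Stage where
  carrier : Type
  [group : Group carrier]
  R : Subgroup carrier
  [normal : R.Normal]

attribute [instance] Stage.group Stage.normal

/-- The step from `(G_{i-1}, R_{i-1})` to `(G_i, R_i)`, where `G_i` is the semidirect product of
`D_i` by `G_{i-1}` and `R_i = D_i'`. -/
def Stage.next (M : Type) [Group M] (S : Stage) : Stage where
  carrier := Next M S.R
  R := nextR M S.R

/-- The input of the construction: a sequence of primes without equal neighbours, and for every
term after the first an extra-special group of the right order. The sequences are indexed from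
`0`, and `M 0` is never used. -/
structure Input where
  p : ℕ → ℕ
  prime : ∀ i, (p i).Prime
  ne : ∀ i, p (i + 1) ≠ p i
  M : ℕ → Type
  [group : ∀ i, Group (M i)]
  extraspecial : ∀ i, IsExtraspecial (p (i + 1)) (M (i + 1))
  card : ∀ i, Nat.card (M (i + 1)) = p (i + 1) ^ 3

attribute [instance] Input.group

namespace Input

variable (I : Input)

/-- The pairs `(G_i, R_i)`, starting with the cyclic group `G_0 = R_0` of order `p_0`. -/
def stage : ℕ → Stage
  | 0 => { carrier := Multiplicative (ZMod (I.p 0)), R := ⊤ }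
  | i + 1 => (stage i).next (I.M (i + 1))

/-- The group `G_i`. -/
abbrev G (i : ℕ) : Type := (I.stage i).carrier

/-- The subgroup `R_i` of `G_i`. -/
abbrev R (i : ℕ) : Subgroup (I.G i) := (I.stage i).R

/-- The embedding of `G_i` in `G_{i+1}` as the complement of `D_{i+1}`. -/
def embSucc (i : ℕ) : I.G i →* I.G (i + 1) :=
  (SemidirectProduct.inr : I.G i →* Next (I.M (i + 1)) (I.R i))

/-- The composite embedding of `G_i` in `G_j` for `i ≤ j`. -/
def emb (i j : ℕ) (h : i ≤ j) : I.G i →* I.G j :=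
  Nat.leRecOn h (fun {k} f => (I.embSucc k).comp f) (MonoidHom.id (I.G i))

theorem emb_self (i : ℕ) : I.emb i i le_rfl = MonoidHom.id (I.G i) :=
  Nat.leRecOn_self _

theorem emb_succ (i j : ℕ) (h : i ≤ j) :
    I.emb i (j + 1) (h.trans j.le_succ) = (I.embSucc j).comp (I.emb i j h) :=
  Nat.leRecOn_succ h _

instance directedSystem : DirectedSystem I.G (fun i j h => I.emb i j h) where
  map_self i x := by rw [emb_self]; rfl
  map_map k j i hij hjk x := by
    induction k, hjk using Nat.le_induction with
    | base => rw [emb_self]; rfl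
    | succ k hjk ih =>
      rw [emb_succ I j k hjk, emb_succ I i k (hij.trans hjk)]
      exact congrArg (I.embSucc k) ih

/-- The direct limit of the groups `G_i`. -/
abbrev Limit : Type := DirectLimit I.G I.emb

noncomputable instance : Group I.Limit := inferInstance

end Input

end WreathTower

/-!
# A tower of extra-special extensions whose limit is hereditarily just infinite

*One step.* Let `K` be a finite group whose nontrivial normal subgroups all contain the normal
subgroup `R` of prime order `q`, and let `M` be extra-special for a prime `p ≠ q`. In
`H / [B', H]` the derived group of the image `P` of the base group is central, and multiplying
together the values of a function identifies it with the centre of `M`, so it has order `p`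
(`card_commutator_baseQuotient`). Since `R` acts coprimely on `P`, the group `D = [P, R]` satisfies
`[D, R] = D` (`commutator_kernelD_map_topHom`), and the commutator form of `P` stays nondegenerate
on `D` (`mem_commutator_baseQuotient_of_commute`); hence `D' = Z(D) = P'`. As `R` acts nontrivially
on `D / D'`, the group `K` acts faithfully there (`exists_commutator_notMem`). So every nontrivial
subgroup of `D ⋊ K` normalized by `D` contains `D'` (`nextR_le_of_ne_one`), and every subgroup
that contains `R` and is normalized by `D` contains `D` (`nextD_le_of_map_inr_le`).

*The limit.* The projections `G_{i+1} → G_i` make each `G_i` a retract of the limit, which gives a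
descending chain of normal subgroups `A_i` of finite index with trivial intersection. If a
nontrivial subgroup `N` is normalized by some `A_i`, then, alternating between the two facts above,
it contains `R_j`, hence `D_{j+1}`, hence `R_{j+1}`, and so on from some `j` onward. So it contains
some `A_j` (`Input.exists_A_le`). This applies to `N` normal in a subgroup of finite index, because
such a subgroup contains some `A_i`.

*The primes.* The quotient `A_i / A_{i+1}` is a `p_i`-group. Conversely, if `N ≤ A_i` is normal in
the limit and `A_i / N` is an `r`-group, then `N` contains `D_i` (if `r ≠ p_i`) or `D_{i+1}`
(if `r = p_i`, since `p_{i+1} ≠ p_i`), hence contains `A_i` or `A_{i+1}` (`Input.A_le_or`). So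
`p_i` and `A_{i+1}` are determined by `A_i`, and an isomorphism of limits carries one chain to the
other and preserves the primes (`Input.p_eq_of_mulEquiv`). Heisenberg groups realize every sequence
of primes, and a diagonal argument yields uncountability.
-/

/-! ### Coprime action -/

section CoprimeAction

open scoped commutatorElement

/-- If a subgroup `R` of exponent dividing `q` normalizes `P`, and every element of `⁅P, R⁆` has
order coprime to `q`, then taking the commutator with `R` a second time changes nothing.
For `y = ⁅x, r⁆` the product `y * r` is a conjugate of `r`, so `(y * r) ^ q = 1`, while `y` and `r`
commute modulo `⁅⁅P, R⁆, R⁆`; hence `y ^ q` lies in that subgroup. -/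
theorem commutator_commutator_eq_of_coprime {W : Type*} [Group W] (P R : Subgroup W) (q : ℕ)
    (hq : ∀ r ∈ R, r ^ q = 1) (hP : ∀ x ∈ ⁅P, R⁆, ∃ n : ℕ, x ^ n = 1 ∧ q.Coprime n)
    (hn : R ≤ Subgroup.normalizer (⁅P, R⁆ : Subgroup W)) :
    ⁅⁅P, R⁆, R⁆ = ⁅P, R⁆ := by
  apply le_antisymm
  · exact Subgroup.le_normalizer_iff_commutator_le_left.mp hn
  rw [Subgroup.commutator_le]
  intro x hx r hr
  set D := ⁅P, R⁆ with hD
  set y := ⁅x, r⁆ with hy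
  have hyD : y ∈ D := Subgroup.commutator_mem_commutator hx hr
  -- `E` is normalized by `D` and `R`; the computation takes place in its normalizer modulo `E`.
  let E := ⁅D, R⁆
  have hDn : D ≤ Subgroup.normalizer (E : Set W) := Subgroup.normalizer_commutator_ge_left _ _
  have hRn : R ≤ Subgroup.normalizer (E : Set W) := Subgroup.normalizer_commutator_ge_right _ _
  let N := Subgroup.normalizer (E : Set W)
  let y' : N := ⟨y, hDn hyD⟩
  let r' : N := ⟨r, hRn hr⟩
  let φ := QuotientGroup.mk' (E.subgroupOf N)
  have hcomm : Commute (φ y') (φ r') := by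
    rw [← commutatorElement_eq_one_iff_commute, ← map_commutatorElement]
    apply (QuotientGroup.eq_one_iff _).mpr
    exact Subgroup.commutator_mem_commutator hyD hr
  have h1 : (φ y') ^ q = 1 := by
    have h2 : (y' * r') ^ q = 1 := by
      apply Subtype.ext
      have : y * r = x * r * x⁻¹ := by simp [hy, commutatorElement_def]
      simp only [y', r', Subgroup.coe_pow, Subgroup.coe_mul, this, conj_pow, hq r hr]
      simp
    have h3 : r' ^ q = 1 := Subtype.ext (hq r hr)
    have := congrArg φ h2
    rwa [map_pow, map_mul, hcomm.mul_pow, ← map_pow φ r', h3, map_one, mul_one] at this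
  obtain ⟨n, hn1, hn2⟩ := hP y hyD
  have h4 : (φ y') ^ n = 1 := by
    rw [← map_pow, show y' ^ n = 1 from Subtype.ext hn1, map_one]
  have h5 : φ y' = 1 := by
    have := orderOf_dvd_of_pow_eq_one h1
    have h' := orderOf_dvd_of_pow_eq_one h4
    exact orderOf_eq_one_iff.mp (Nat.eq_one_of_dvd_coprimes hn2 this h')
  have h6 : y' ∈ E.subgroupOf N := (QuotientGroup.eq_one_iff _).mp h5
  exact h6

end CoprimeAction

namespace IsExtraspecial

open scoped commutatorElement

variable {p : ℕ} {M : Type*} [Group M]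

theorem commutatorElement_mem_center (hM : IsExtraspecial p M) (a b : M) :
    ⁅a, b⁆ ∈ Subgroup.center M := by
  rw [← hM.commutator_eq_center, commutator_def]
  exact Subgroup.commutator_mem_commutator (Subgroup.mem_top _) (Subgroup.mem_top _)

theorem exists_notMem_center (hM : IsExtraspecial p M) (hp : p ≠ 1) :
    ∃ m : M, m ∉ Subgroup.center M := by
  by_contra! h
  have h1 : Subgroup.center M = ⊤ := top_le_iff.mp fun m _ => h m
  have h2 := (commutator_eq_bot_iff_center_eq_top (G := M)).mpr h1
  rw [hM.commutator_eq_center] at h2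
  have := hM.card_center
  rw [h2, Subgroup.card_bot] at this
  exact hp this.symm

end IsExtraspecial

/-! ### The base group of the wreath product modulo `[B', H]` -/

namespace WreathTower

open scoped commutatorElement IsMulCommutative

open RegularWreathProduct

section Wreath

variable (M K : Type) [Group M] [Group K]

/-- The function `f : K → M` as an element of the base group of `M ≀ K`. -/
def baseFun : (K → M) →* M ≀ᵣ K where
  toFun f := ⟨f, 1⟩
  map_one' := rfl
  map_mul' f g := by ext <;> simp

/-- The function `f : K → M` as an element of `H / [B', H]`. -/
def toQuotient : (K → M) →* WreathQuotient M K :=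
  (QuotientGroup.mk' (killed M K)).comp (baseFun M K)

/-- The inclusion of functions with central values into all functions. -/
def centralFun : (K → Subgroup.center M) →* (K → M) where
  toFun c k := c k
  map_one' := rfl
  map_mul' _ _ := rfl

omit [Group K] in
@[simp]
theorem centralFun_apply (c : K → Subgroup.center M) (k : K) : centralFun M K c k = c k := rfl

variable {M K}

theorem range_baseFun : (baseFun M K).range = base M K := by
  ext x
  constructor
  · rintro ⟨f, rfl⟩
    rfl
  · intro h
    have h : x.right = 1 := h
    exact ⟨x.left, RegularWreathProduct.ext rfl h.symm⟩

theorem range_toQuotient : (toQuotient M K).range = baseQuotient M K := by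
  rw [toQuotient, MonoidHom.range_comp, range_baseFun, baseQuotient]

theorem conj_baseFun (w : M ≀ᵣ K) (c : K → Subgroup.center M) :
    w * baseFun M K (centralFun M K c) * w⁻¹ =
      baseFun M K (centralFun M K fun k => c (w.right⁻¹ * k)) := by
  ext k
  · have h := Subgroup.mem_center_iff.mp (c (w.right⁻¹ * k)).2 (w.left k)
    simp [baseFun, h]
  · simp [baseFun]

theorem conj_toQuotient (k : K) (f : K → M) :
    topHom M K k * toQuotient M K f * (topHom M K k)⁻¹ =
      toQuotient M K fun x => f (k⁻¹ * x) := by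
  have h : inl k * baseFun M K f * (inl k)⁻¹ = baseFun M K fun x => f (k⁻¹ * x) := by
    ext x <;> simp [baseFun]
  have h' := congrArg (QuotientGroup.mk' (killed M K)) h
  rwa [map_mul, map_mul, map_inv] at h'

theorem commutator_toQuotient_topHom (k : K) (f : K → M) :
    ⁅toQuotient M K f, topHom M K k⁆ = toQuotient M K (f * fun x => (f (k⁻¹ * x))⁻¹) := by
  have h := conj_toQuotient k f⁻¹
  rw [commutatorElement_def, mul_assoc, mul_assoc, ← mul_assoc (topHom M K k), ← map_inv, h,
    ← map_mul]
  rfl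

theorem map_commutator_base :
    ⁅base M K, base M K⁆.map (QuotientGroup.mk' (killed M K)) =
      ⁅baseQuotient M K, baseQuotient M K⁆ := by
  rw [Subgroup.map_commutator, baseQuotient]

/-- The derived group of `B / [B', H]` is central in `H / [B', H]`. -/
theorem commutator_baseQuotient_le_center :
    ⁅baseQuotient M K, baseQuotient M K⁆ ≤ Subgroup.center (WreathQuotient M K) := by
  rw [← Subgroup.commutator_top_right_eq_bot_iff_le_center, ← map_commutator_base,
    ← Subgroup.map_top_of_surjective _ (QuotientGroup.mk'_surjective (killed M K)),
    ← Subgroup.map_commutator]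
  change (killed M K).map _ = ⊥
  rw [QuotientGroup.map_mk'_self]

variable {p : ℕ} (hM : IsExtraspecial p M)
include hM

theorem exists_centralFun_of_mem_commutator_base {x : M ≀ᵣ K} (hx : x ∈ ⁅base M K, base M K⁆) :
    ∃ c, baseFun M K (centralFun M K c) = x := by
  have h : ⁅base M K, base M K⁆ ≤ ((baseFun M K).comp (centralFun M K)).range := by
    rw [Subgroup.commutator_le, ← range_baseFun]
    rintro _ ⟨f, rfl⟩ _ ⟨g, rfl⟩
    exact ⟨fun k => ⟨⁅f k, g k⁆, hM.commutatorElement_mem_center _ _⟩,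
      by rw [← map_commutatorElement]; rfl⟩
  exact h hx

/-- The elements of `[B', H]` are functions with central values whose product is trivial. -/
theorem exists_prod_eq_one_of_mem_killed [Fintype K] {x : M ≀ᵣ K} (hx : x ∈ killed M K) :
    ∃ c : K → Subgroup.center M, ∏ k, c k = 1 ∧ baseFun M K (centralFun M K c) = x := by
  let σ : (K → Subgroup.center M) →* Subgroup.center M :=
    { toFun := fun c => ∏ k, c k
      map_one' := by simp
      map_mul' := fun c d => by simp [Finset.prod_mul_distrib] }
  have h : killed M K ≤ σ.ker.map ((baseFun M K).comp (centralFun M K)) := by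
    rw [killed, Subgroup.commutator_le]
    intro x hx w _
    obtain ⟨c, rfl⟩ := exists_centralFun_of_mem_commutator_base hM hx
    refine ⟨c * (fun k => c⁻¹ (w.right⁻¹ * k)), ?_, ?_⟩
    · change ∏ k, c k * (c (w.right⁻¹ * k))⁻¹ = 1
      rw [Finset.prod_mul_distrib, Finset.prod_inv_distrib,
        Fintype.prod_equiv (Equiv.mulLeft w.right⁻¹) (fun k => c (w.right⁻¹ * k)) c
          (fun k => rfl), mul_inv_cancel]
    · rw [map_mul, commutatorElement_def, mul_assoc, mul_assoc, ← mul_assoc w]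
      congr 1
      have := conj_baseFun w c⁻¹
      rw [map_inv, map_inv] at this
      rw [this]
      rfl
  obtain ⟨c, hc, hcx⟩ := h hx
  exact ⟨c, hc, hcx⟩

theorem exists_prod_eq_one_of_toQuotient_eq_one [Fintype K] {f : K → M}
    (hf : toQuotient M K f = 1) :
    ∃ c : K → Subgroup.center M, ∏ k, c k = 1 ∧ centralFun M K c = f := by
  obtain ⟨c, h1, h2⟩ := exists_prod_eq_one_of_mem_killed hM ((QuotientGroup.eq_one_iff _).mp hf)
  exact ⟨c, h1, congrArg RegularWreathProduct.left h2⟩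

theorem exists_centralFun_of_mem_commutator_baseQuotient {x : WreathQuotient M K}
    (hx : x ∈ ⁅baseQuotient M K, baseQuotient M K⁆) :
    ∃ c, toQuotient M K (centralFun M K c) = x := by
  rw [← map_commutator_base] at hx
  obtain ⟨y, hy, rfl⟩ := hx
  obtain ⟨c, rfl⟩ := exists_centralFun_of_mem_commutator_base hM hy
  exact ⟨c, rfl⟩

theorem toQuotient_mulSingle_mem [DecidableEq K] (k : K) (z : Subgroup.center M) :
    toQuotient M K (Pi.mulSingle k (z : M)) ∈ ⁅baseQuotient M K, baseQuotient M K⁆ := by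
  have hz : (z : M) ∈ ⁅(⊤ : Subgroup M), (⊤ : Subgroup M)⁆ := by
    rw [← commutator_def, hM.commutator_eq_center]
    exact z.2
  have h := Subgroup.mem_map_of_mem
    ((toQuotient M K).comp (MonoidHom.mulSingle (fun _ : K => M) k)) hz
  rw [Subgroup.map_commutator] at h
  refine Subgroup.commutator_mono ?_ ?_ h <;>
  · rw [← range_toQuotient]
    rintro _ ⟨m, _, rfl⟩
    exact ⟨_, rfl⟩

theorem toQuotient_mulSingle [DecidableEq K] (k : K) (z : Subgroup.center M) :
    toQuotient M K (Pi.mulSingle k (z : M)) = toQuotient M K (Pi.mulSingle 1 (z : M)) := by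
  have h := conj_toQuotient k (Pi.mulSingle 1 (z : M))
  have hc := Subgroup.mem_center_iff.mp
    (commutator_baseQuotient_le_center (toQuotient_mulSingle_mem hM 1 z)) (topHom M K k)
  rw [hc, mul_inv_cancel_right] at h
  rw [h]
  congr 1
  ext x
  simp only [Pi.mulSingle_apply, inv_mul_eq_one]
  simp [eq_comm]

theorem toQuotient_centralFun [Fintype K] [DecidableEq K] (c : K → Subgroup.center M) :
    toQuotient M K (centralFun M K c) =
      toQuotient M K (Pi.mulSingle 1 ((∏ k, c k : Subgroup.center M) : M)) := by
  induction c using Pi.mulSingle_induction with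
  | one => simp
  | mul f g hf hg =>
    simp only [map_mul, hf, hg, Pi.mul_apply, Finset.prod_mul_distrib, Subgroup.coe_mul,
      Pi.mulSingle_mul]
  | mulSingle k z =>
    rw [Finset.prod_pi_mulSingle', if_pos (Finset.mem_univ k), ← toQuotient_mulSingle hM k]
    congr 1
    ext x
    by_cases h : x = k
    · subst h; simp
    · simp [h]

theorem mem_center_of_toQuotient_mem [Finite K] {f : K → M}
    (hf : toQuotient M K f ∈ ⁅baseQuotient M K, baseQuotient M K⁆) (k : K) :
    f k ∈ Subgroup.center M := by
  have := Fintype.ofFinite K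
  obtain ⟨c, hc⟩ := exists_centralFun_of_mem_commutator_baseQuotient hM hf
  have h : toQuotient M K (f * (centralFun M K c)⁻¹) = 1 := by simp [hc]
  obtain ⟨d, -, hd⟩ := exists_prod_eq_one_of_toQuotient_eq_one hM h
  rw [eq_mul_inv_iff_mul_eq, ← map_mul] at hd
  rw [← hd]
  exact ((d * c) k).2

theorem toQuotient_mem_of_mem_center [Finite K] {f : K → M}
    (hf : ∀ k, f k ∈ Subgroup.center M) :
    toQuotient M K f ∈ ⁅baseQuotient M K, baseQuotient M K⁆ := by
  classical
  have := Fintype.ofFinite K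
  have := toQuotient_centralFun hM (fun k => (⟨f k, hf k⟩ : Subgroup.center M))
  change toQuotient M K f = _ at this
  rw [this]
  exact toQuotient_mulSingle_mem hM _ _

/-- The derived group of `B / [B', H]` is a copy of the centre of `M`: the product of the values
identifies it. -/
theorem card_commutator_baseQuotient [Finite K] :
    Nat.card (⁅baseQuotient M K, baseQuotient M K⁆ : Subgroup (WreathQuotient M K)) = p := by
  classical
  have := Fintype.ofFinite K
  let s : Subgroup.center M →* WreathQuotient M K :=
    (toQuotient M K).comp ((MonoidHom.mulSingle (fun _ => M) (1 : K)).comp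
      (Subgroup.center M).subtype)
  have hs : ∀ z, s z = toQuotient M K (Pi.mulSingle 1 (z : M)) := fun _ => rfl
  have hrange : s.range = ⁅baseQuotient M K, baseQuotient M K⁆ := by
    apply le_antisymm
    · rintro _ ⟨z, rfl⟩
      exact toQuotient_mulSingle_mem hM 1 z
    · intro x hx
      obtain ⟨c, rfl⟩ := exists_centralFun_of_mem_commutator_baseQuotient hM hx
      exact ⟨∏ k, c k, (toQuotient_centralFun hM c).symm⟩
  have hinj : Function.Injective s := by
    rw [injective_iff_map_eq_one]
    intro z hz
    obtain ⟨c, h1, h2⟩ := exists_prod_eq_one_of_toQuotient_eq_one hM ((hs z).symm.trans hz)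
    have h3 : c = Pi.mulSingle 1 z := by
      ext x
      have := congrFun h2 x
      rw [centralFun_apply] at this
      rw [this]
      by_cases h : x = 1
      · subst h; simp
      · simp [h]
    rwa [h3, Finset.prod_pi_mulSingle', if_pos (Finset.mem_univ _)] at h1
  rw [← hrange, ← hM.card_center]
  exact (Nat.card_congr (MonoidHom.ofInjective hinj).toEquiv).symm

end Wreath

/-! ### The group `D` -/

section KernelD

variable {M K : Type} [Group M] [Group K]

theorem kernelD_le_baseQuotient (R : Subgroup K) : kernelD M R ≤ baseQuotient M K :=
  Subgroup.commutator_le_left _ _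

theorem toQuotient_mem_kernelD {R : Subgroup K} {r : K} (hr : r ∈ R) (f : K → M) :
    toQuotient M K (f * fun x => (f (r⁻¹ * x))⁻¹) ∈ kernelD M R := by
  rw [← commutator_toQuotient_topHom]
  exact Subgroup.commutator_mem_commutator (range_toQuotient (M := M) (K := K) ▸ ⟨f, rfl⟩)
    (Subgroup.mem_map_of_mem _ hr)

theorem toQuotient_mulSingle_mem_kernelD [DecidableEq K] {R : Subgroup K} {r : K} (hr : r ∈ R)
    (k : K) (m : M) :
    toQuotient M K (Pi.mulSingle k m * Pi.mulSingle (r * k) m⁻¹) ∈ kernelD M R := by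
  convert toQuotient_mem_kernelD hr (Pi.mulSingle k m) using 3
  ext x
  simp only [Pi.mulSingle_apply, inv_mul_eq_iff_eq_mul]
  split_ifs <;> simp

/-- An element of `[B, R]` is represented by a function whose product over every coset of `R` is
trivial modulo the centre of `M`. -/
theorem exists_prod_coset_eq_one_of_mem_kernelD {R : Subgroup K} [Fintype R]
    [IsMulCommutative (M ⧸ Subgroup.center M)] {x : WreathQuotient M K} (hx : x ∈ kernelD M R) :
    ∃ f : K → M, toQuotient M K f = x ∧
      ∀ k, ∏ r : R, (f (r * k) : M ⧸ Subgroup.center M) = 1 := by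
  let T : (K → M) →* (K → M ⧸ Subgroup.center M) :=
    { toFun := fun f k => ∏ r : R, (f (r * k) : M ⧸ Subgroup.center M)
      map_one' := by ext; simp
      map_mul' := fun f g => by ext; simp [Finset.prod_mul_distrib] }
  have h : kernelD M R ≤ T.ker.map (toQuotient M K) := by
    rw [kernelD, Subgroup.commutator_le, ← range_toQuotient]
    rintro _ ⟨f, rfl⟩ _ ⟨r, hr, rfl⟩
    rw [commutator_toQuotient_topHom]
    refine ⟨_, ?_, rfl⟩
    ext k
    change ∏ s : R, ((f (s * k) * (f (r⁻¹ * (s * k)))⁻¹ : M) : M ⧸ Subgroup.center M) = 1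
    simp only [QuotientGroup.mk_mul, QuotientGroup.mk_inv, Finset.prod_mul_distrib,
      Finset.prod_inv_distrib]
    rw [mul_inv_eq_one]
    symm
    exact Fintype.prod_equiv (Equiv.mulLeft (⟨r, hr⟩ : R)⁻¹) _ _ fun s => by simp [mul_assoc]
  obtain ⟨f, hf, rfl⟩ := h hx
  exact ⟨f, rfl, fun k => congrFun hf k⟩

variable {p : ℕ} (hM : IsExtraspecial p M)
include hM

/-- If the class of `f` commutes with `[B, R]`, then `f` is constant on the cosets of `R`
modulo the centre of `M`. -/
theorem mk_eq_mk_of_commute_kernelD [Finite K] {R : Subgroup K} {f : K → M}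
    (hf : ∀ d ∈ kernelD M R, Commute (toQuotient M K f) d) {r : K} (hr : r ∈ R) (k : K) :
    (f (r * k) : M ⧸ Subgroup.center M) = f k := by
  classical
  have := Fintype.ofFinite K
  by_cases hr1 : r = 1
  · simp [hr1]
  have hne : k ≠ r * k := fun h => hr1 (by simpa using h.symm)
  rw [eq_comm, QuotientGroup.eq, Subgroup.mem_center_iff]
  intro m
  have h1 := (hf _ (toQuotient_mulSingle_mem_kernelD hr k m)).commutator_eq
  rw [← map_commutatorElement] at h1
  obtain ⟨c, hc1, hc2⟩ := exists_prod_eq_one_of_toQuotient_eq_one hM h1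
  have hval : ∀ x, (c x : M) = ⁅f x, (Pi.mulSingle k m : K → M) x *
      (Pi.mulSingle (r * k) m⁻¹ : K → M) x⁆ := fun x => congrFun hc2 x
  have hk : (c k : M) = ⁅f k, m⁆ := by
    rw [hval, Pi.mulSingle_eq_same, Pi.mulSingle_eq_of_ne hne, mul_one]
  have hrk : (c (r * k) : M) = ⁅f (r * k), m⁻¹⁆ := by
    rw [hval, Pi.mulSingle_eq_same, Pi.mulSingle_eq_of_ne hne.symm, one_mul]
  have hprod : c k * c (r * k) = 1 := by
    rw [← hc1]
    refine (Fintype.prod_eq_mul k (r * k) hne ?_).symm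
    rintro x ⟨hx1, hx2⟩
    apply Subtype.ext
    rw [hval, Pi.mulSingle_eq_of_ne hx1, Pi.mulSingle_eq_of_ne hx2]
    simp
  have hprod' : ⁅f k, m⁆ * ⁅f (r * k), m⁻¹⁆ = 1 := by
    rw [← hk, ← hrk, ← Subgroup.coe_mul, hprod, Subgroup.coe_one]
  have hcen := Subgroup.mem_center_iff.mp
    (hM.commutatorElement_mem_center (f (r * k)) m⁻¹) m
  generalize f k = a, f (r * k) = b at *
  simp only [commutatorElement_def, inv_inv] at hprod' hcen
  have e : a * m * a⁻¹ = b * m * b⁻¹ := by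
    have hw : Commute m (b * m⁻¹ * b⁻¹ * m)⁻¹ := Commute.inv_right hcen
    calc a * m * a⁻¹ = a * m * a⁻¹ * m⁻¹ * m := by group
      _ = m * (b * m⁻¹ * b⁻¹ * m)⁻¹ := by rw [mul_eq_one_iff_eq_inv.mp hprod', hw.eq]
      _ = b * m * b⁻¹ := by group
  calc m * (a⁻¹ * b) = a⁻¹ * (a * m * a⁻¹) * b := by group
    _ = a⁻¹ * b * m := by rw [e]; group

theorem isMulCommutative_quotient_center : IsMulCommutative (M ⧸ Subgroup.center M) :=
  (Subgroup.Normal.quotient_commutative_iff_commutator_le).mpr hM.commutator_eq_center.le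

/-- The form on `[B, R]` given by commutators is nondegenerate. If `f` represents an element of
`[B, R]` that commutes with `[B, R]`, then modulo the centre of `M` the function `f` is constant on
each coset of `R` and has trivial product there, so its values have order dividing `|R|`. -/
theorem mem_commutator_baseQuotient_of_commute [Finite K] {R : Subgroup K}
    (hR : (Nat.card R).Coprime p) {x : WreathQuotient M K} (hx : x ∈ kernelD M R)
    (hc : ∀ d ∈ kernelD M R, Commute x d) : x ∈ ⁅baseQuotient M K, baseQuotient M K⁆ := by
  have := isMulCommutative_quotient_center hM
  have := Fintype.ofFinite R
  obtain ⟨f, rfl, hf⟩ := exists_prod_coset_eq_one_of_mem_kernelD hx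
  refine toQuotient_mem_of_mem_center hM fun k => ?_
  have h1 := hf k
  rw [Finset.prod_congr rfl fun (r : R) _ => mk_eq_mk_of_commute_kernelD hM hc r.2 k,
    Finset.prod_const, Finset.card_univ, ← Nat.card_eq_fintype_card] at h1
  obtain ⟨n, hn⟩ := hM.isPGroup.to_quotient (Subgroup.center M) (f k)
  exact (QuotientGroup.eq_one_iff _).mp (orderOf_eq_one_iff.mp (Nat.eq_one_of_dvd_coprimes
    (hR.pow_right n) (orderOf_dvd_of_pow_eq_one h1) (orderOf_dvd_of_pow_eq_one hn)))

theorem not_kernelD_le [Finite K] {R : Subgroup K} (hR : R ≠ ⊥) (hp : p ≠ 1) :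
    ¬ kernelD M R ≤ ⁅baseQuotient M K, baseQuotient M K⁆ := by
  classical
  intro h
  obtain ⟨m, hm⟩ := hM.exists_notMem_center hp
  obtain ⟨r, hr, hr1⟩ := R.bot_or_exists_ne_one.resolve_left hR
  have h1 := mem_center_of_toQuotient_mem hM (h (toQuotient_mulSingle_mem_kernelD hr 1 m)) 1
  rw [Pi.mul_apply, Pi.mulSingle_eq_same, mul_one, Pi.mulSingle_eq_of_ne (Ne.symm hr1),
    mul_one] at h1
  exact hm h1

theorem isPGroup_kernelD [Finite K] (R : Subgroup K) : IsPGroup p (kernelD M R) := by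
  have hpi : IsPGroup p (K → M) := by
    intro f
    have := Fintype.ofFinite K
    choose n hn using fun k => hM.isPGroup (f k)
    refine ⟨∑ k, n k, funext fun k => ?_⟩
    rw [Pi.pow_apply, Pi.one_apply, ← orderOf_dvd_iff_pow_eq_one]
    exact (orderOf_dvd_of_pow_eq_one (hn k)).trans
      (pow_dvd_pow p (Finset.single_le_sum (fun _ _ => Nat.zero_le _) (Finset.mem_univ k)))
  have h2 : IsPGroup p (toQuotient M K).range :=
    hpi.of_surjective _ (toQuotient M K).rangeRestrict_surjective
  rw [range_toQuotient] at h2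
  exact h2.to_le (kernelD_le_baseQuotient R)

theorem commutator_kernelD_map_topHom [Finite K] {R : Subgroup K} [R.Normal]
    (hR : (Nat.card R).Coprime p) : ⁅kernelD M R, R.map (topHom M K)⁆ = kernelD M R := by
  refine commutator_commutator_eq_of_coprime _ _ (Nat.card R) ?_ ?_ ?_
  · rintro _ ⟨r, hr, rfl⟩
    have : (⟨r, hr⟩ : R) ^ Nat.card R = 1 := pow_card_eq_one'
    rw [← map_pow, show r ^ Nat.card R = 1 from congrArg Subtype.val this, map_one]
  · intro x hx
    obtain ⟨n, hn⟩ := isPGroup_kernelD hM R ⟨x, hx⟩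
    exact ⟨p ^ n, congrArg Subtype.val hn, hR.pow_right n⟩
  · exact Subgroup.normalizer_commutator_ge_right _ _

theorem commutator_kernelD [Finite K] {R : Subgroup K} (hp : p.Prime)
    (hR : (Nat.card R).Coprime p) (hR1 : R ≠ ⊥) :
    ⁅kernelD M R, kernelD M R⁆ = ⁅baseQuotient M K, baseQuotient M K⁆ := by
  have hle : ⁅kernelD M R, kernelD M R⁆ ≤ ⁅baseQuotient M K, baseQuotient M K⁆ :=
    Subgroup.commutator_mono (kernelD_le_baseQuotient R) (kernelD_le_baseQuotient R)
  refine (hle.eq_or_lt).resolve_right fun hlt => not_kernelD_le hM hR1 hp.ne_one fun x hx => ?_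
  have hbot : ⁅kernelD M R, kernelD M R⁆ = ⊥ := by
    have hfin : Finite (⁅baseQuotient M K, baseQuotient M K⁆ : Subgroup (WreathQuotient M K)) :=
      Nat.finite_of_card_ne_zero (by rw [card_commutator_baseQuotient hM]; exact hp.ne_zero)
    have hd := Subgroup.card_dvd_of_le hle
    rw [card_commutator_baseQuotient hM] at hd
    rcases (Nat.dvd_prime hp).mp hd with h | h
    · exact Subgroup.card_eq_one.mp h
    · exact absurd (Subgroup.eq_of_le_of_card_ge hle
        (by rw [h, card_commutator_baseQuotient hM])) hlt.ne
  refine mem_commutator_baseQuotient_of_commute hM hR hx fun d hd => ?_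
  rw [← commutatorElement_eq_one_iff_commute, ← Subgroup.mem_bot, ← hbot]
  exact Subgroup.commutator_mem_commutator hx hd

/-- If every nontrivial normal subgroup of `K` contains `R`, then `K` acts faithfully on
`[B, R]` modulo its centre. -/
theorem exists_commutator_notMem [Finite K] {R : Subgroup K} [R.Normal] (hp : p.Prime)
    (hR : (Nat.card R).Coprime p) (hR1 : R ≠ ⊥)
    (hmin : ∀ L : Subgroup K, L.Normal → L ≠ ⊥ → R ≤ L) {k : K} (hk : k ≠ 1) :
    ∃ d ∈ kernelD M R, ⁅d, topHom M K k⁆ ∉ ⁅baseQuotient M K, baseQuotient M K⁆ := by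
  by_contra! h
  let π := QuotientGroup.mk' ⁅baseQuotient M K, baseQuotient M K⁆
  have hN : ((kernelD M R).map π).Normal :=
    Subgroup.Normal.map inferInstance _ (QuotientGroup.mk'_surjective _)
  let C : Subgroup K := (Subgroup.centralizer ((kernelD M R).map π : Set _)).comap
    (π.comp (topHom M K))
  have hC : ∀ k, k ∈ C ↔ ∀ d ∈ kernelD M R,
      ⁅d, topHom M K k⁆ ∈ ⁅baseQuotient M K, baseQuotient M K⁆ := by
    intro k
    rw [Subgroup.mem_comap, Subgroup.mem_centralizer_iff]
    simp only [SetLike.mem_coe, Subgroup.mem_map, forall_exists_index, and_imp,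
      forall_apply_eq_imp_iff₂]
    refine forall₂_congr fun d _ => ?_
    rw [MonoidHom.comp_apply, ← commutatorElement_eq_one_iff_mul_comm, ← map_commutatorElement]
    exact QuotientGroup.eq_one_iff _
  have hCn : C.Normal := inferInstance
  have hRC := hmin C hCn fun hC0 => hk (by
    rw [← Subgroup.mem_bot, ← hC0, hC]
    exact h)
  refine not_kernelD_le hM hR1 hp.ne_one ?_
  rw [← commutator_kernelD_map_topHom hM hR, Subgroup.commutator_le]
  rintro d hd _ ⟨r, hr, rfl⟩
  exact (hC r).mp (hRC hr) d hd

end KernelD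

/-! ### One step of the construction -/

section NextStep

theorem commutator_mem_of_le_normalizer {G : Type*} [Group G] {D L : Subgroup G}
    (h : D ≤ Subgroup.normalizer (L : Set G)) {x d : G} (hx : x ∈ L) (hd : d ∈ D) : ⁅x, d⁆ ∈ L :=
  Subgroup.le_normalizer_iff_commutator_le_left.mp h (Subgroup.commutator_mem_commutator hx hd)

theorem le_of_card_prime {G : Type*} [Group G] {p : ℕ} {L Z : Subgroup G} (hp : p.Prime)
    (hZ : Nat.card Z = p) {z : G} (hz : z ∈ Z) (hzL : z ∈ L) (hz1 : z ≠ 1) : Z ≤ L := by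
  have : Fact (Nat.card Z).Prime := ⟨hZ ▸ hp⟩
  rcases (L.subgroupOf Z).eq_bot_or_eq_top_of_prime_card with h1 | h1
  · have : (⟨z, hz⟩ : Z) ∈ L.subgroupOf Z := hzL
    rw [h1, Subgroup.mem_bot] at this
    exact absurd (congrArg Subtype.val this) hz1
  · exact Subgroup.subgroupOf_eq_top.mp h1

variable {M K : Type} [Group M] [Group K] {R : Subgroup K} [R.Normal]

variable (M R) in
/-- The group `D` as a normal subgroup of the semidirect product of `D` by `K`. -/
def nextD : Subgroup (Next M R) := (SemidirectProduct.rightHom : Next M R →* K).ker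

instance : (nextD M R).Normal := by unfold nextD; infer_instance

variable (M R) in
/-- The embedding of `K` in the semidirect product of `D` by `K`. -/
abbrev nextInr : K →* Next M R := SemidirectProduct.inr

/-- The embedding of `D` in the semidirect product of `D` by `K`. -/
abbrev nextInl : kernelD M R →* Next M R := SemidirectProduct.inl

theorem range_inl_eq_nextD : (nextInl : kernelD M R →* Next M R).range = nextD M R :=
  SemidirectProduct.range_inl_eq_ker_rightHom

theorem inl_mem_nextD (d : kernelD M R) : nextInl d ∈ nextD M R :=
  SemidirectProduct.rightHom_inl d

theorem nextR_eq : nextR M R = ⁅nextD M R, nextD M R⁆ := by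
  rw [nextR, commutator_def, Subgroup.map_commutator, ← MonoidHom.range_eq_map, range_inl_eq_nextD]

theorem actD_apply_coe (k : K) (d : kernelD M R) :
    ((actD M R k d : kernelD M R) : WreathQuotient M K) =
      topHom M K k * d * (topHom M K k)⁻¹ := rfl

theorem inl_mul_inr (d : kernelD M R) (k : K) :
    nextInr M R k * nextInl d * (nextInr M R k)⁻¹ =
      nextInl (actD M R k d) := by
  rw [← map_inv]
  exact (SemidirectProduct.inl_aut k d).symm

theorem commutator_inl_inr (d : kernelD M R) (k : K) :
    ∃ e : kernelD M R, (e : WreathQuotient M K) = ⁅(d : WreathQuotient M K), topHom M K k⁆ ∧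
      ⁅nextInl d, nextInr M R k⁆ =
        nextInl e := by
  refine ⟨d * actD M R k d⁻¹, ?_, ?_⟩
  · simp only [Subgroup.coe_mul, actD_apply_coe, commutatorElement_def, Subgroup.coe_inv]
    group
  · rw [map_mul, ← inl_mul_inr, map_inv, commutatorElement_def]
    group

variable {p : ℕ} (hM : IsExtraspecial p M)
include hM

theorem isPGroup_nextD [Finite K] : IsPGroup p (nextD M R) := by
  rw [← range_inl_eq_nextD]
  exact (isPGroup_kernelD hM R).of_surjective _ (MonoidHom.rangeRestrict_surjective _)

variable [Finite K] (hR : (Nat.card R).Coprime p)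
include hR

theorem nextD_le_of_map_inr_le {L : Subgroup (Next M R)} (hL : R.map (nextInr M R) ≤ L)
    (hn : nextD M R ≤ Subgroup.normalizer (L : Set (Next M R))) : nextD M R ≤ L := by
  have h : kernelD M R ≤ (L.comap nextInl).map (kernelD M R).subtype := by
    conv_lhs => rw [← commutator_kernelD_map_topHom hM hR]
    rw [Subgroup.commutator_le]
    rintro d hd _ ⟨r, hr, rfl⟩
    obtain ⟨e, he1, he2⟩ := commutator_inl_inr ⟨d, hd⟩ r
    refine ⟨e, ?_, he1⟩
    rw [SetLike.mem_coe, Subgroup.mem_comap, ← he2]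
    exact Subgroup.le_normalizer_iff_commutator_le_right.mp hn
      (Subgroup.commutator_mem_commutator (inl_mem_nextD _) (hL (Subgroup.mem_map_of_mem _ hr)))
  rw [← range_inl_eq_nextD]
  rintro _ ⟨d, rfl⟩
  obtain ⟨e, he, hed⟩ := h d.2
  rwa [← show e = d from Subtype.ext hed]

variable (hp : p.Prime) (hR1 : R ≠ ⊥)
include hp hR1

omit [R.Normal] in
theorem map_subtype_commutator_kernelD :
    (commutator (kernelD M R)).map (kernelD M R).subtype =
      ⁅baseQuotient M K, baseQuotient M K⁆ := by
  rw [Subgroup.map_subtype_commutator, commutator_kernelD hM hp hR hR1]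

omit [R.Normal] in
theorem mem_commutator_kernelD_iff (d : kernelD M R) :
    d ∈ commutator (kernelD M R) ↔
      (d : WreathQuotient M K) ∈ ⁅baseQuotient M K, baseQuotient M K⁆ := by
  rw [← map_subtype_commutator_kernelD hM hR hp hR1]
  exact (Subgroup.mem_map_iff_mem (kernelD M R).subtype_injective).symm

theorem card_nextR : Nat.card (nextR M R) = p := by
  rw [← card_commutator_baseQuotient (K := K) hM, ← map_subtype_commutator_kernelD hM hR hp hR1,
    nextR, Subgroup.card_map_of_injective SemidirectProduct.inl_injective,
    Subgroup.card_map_of_injective (kernelD M R).subtype_injective]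

theorem nextR_le_center : nextR M R ≤ Subgroup.center (Next M R) := by
  rintro _ ⟨z, hz, rfl⟩
  have hz' := Subgroup.mem_center_iff.mp
    (commutator_baseQuotient_le_center ((mem_commutator_kernelD_iff hM hR hp hR1 z).mp hz))
  rw [Subgroup.mem_center_iff]
  intro g
  rw [← SemidirectProduct.inl_left_mul_inr_right g]
  have h1 : g.left * z = z * g.left := Subtype.ext (hz' _)
  have h2 : actD M R g.right z = z := Subtype.ext (by
    rw [actD_apply_coe, hz', mul_inv_cancel_right])
  have h3 := inl_mul_inr z g.right
  rw [h2, mul_inv_eq_iff_eq_mul] at h3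
  rw [mul_assoc, h3, ← mul_assoc, ← map_mul, h1, map_mul, mul_assoc]

omit [R.Normal] in
theorem exists_commutator_ne_one {d : kernelD M R} (hd : d ∉ commutator (kernelD M R)) :
    ∃ e : kernelD M R, ⁅d, e⁆ ≠ 1 := by
  by_contra! h
  refine hd ((mem_commutator_kernelD_iff hM hR hp hR1 d).mpr
    (mem_commutator_baseQuotient_of_commute hM hR d.2 fun e he => ?_))
  exact congrArg Subtype.val (commutatorElement_eq_one_iff_commute.mp (h ⟨e, he⟩)).eq

/-- A nontrivial subgroup of `D` normalized by `D` contains `D'`. -/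
theorem nextR_le_of_mem_nextD {L : Subgroup (Next M R)} {x : Next M R} (hxL : x ∈ L)
    (hxD : x ∈ nextD M R) (hx : x ≠ 1)
    (hn : nextD M R ≤ Subgroup.normalizer (L : Set (Next M R))) : nextR M R ≤ L := by
  by_cases hxR : x ∈ nextR M R
  · exact le_of_card_prime hp (card_nextR hM hR hp hR1) hxR hxL hx
  rw [← range_inl_eq_nextD] at hxD
  obtain ⟨d, rfl⟩ := hxD
  obtain ⟨e, he⟩ := exists_commutator_ne_one hM hR hp hR1 (d := d)
    fun h => hxR (Subgroup.mem_map_of_mem _ h)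
  refine le_of_card_prime hp (card_nextR hM hR hp hR1) (z := nextInl ⁅d, e⁆)
    (Subgroup.mem_map_of_mem _
      (Subgroup.commutator_mem_commutator (Subgroup.mem_top d) (Subgroup.mem_top e))) ?_ ?_
  · rw [map_commutatorElement]
    exact commutator_mem_of_le_normalizer hn hxL (inl_mem_nextD e)
  · rwa [Ne, map_eq_one_iff _ SemidirectProduct.inl_injective]

/-- If `D` normalizes `L` and `L` is not trivial, then `L` contains `D'`, as soon as `R` lies in
every nontrivial normal subgroup of `K`: the group `K` then acts faithfully on `D / D'`, so the
commutator of an element outside `D` with some element of `D` lies in `D` and is nontrivial. -/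
theorem nextR_le_of_ne_one (hmin : ∀ L : Subgroup K, L.Normal → L ≠ ⊥ → R ≤ L)
    {L : Subgroup (Next M R)} {x : Next M R} (hxL : x ∈ L) (hx : x ≠ 1)
    (hn : nextD M R ≤ Subgroup.normalizer (L : Set (Next M R))) : nextR M R ≤ L := by
  by_cases hxD : x ∈ nextD M R
  · exact nextR_le_of_mem_nextD hM hR hp hR1 hxL hxD hx hn
  have hk : x.right ≠ 1 := hxD
  obtain ⟨d, hd, hdk⟩ := exists_commutator_notMem hM hp hR hR1 hmin hk
  let y : Next M R := nextInl ⟨d, hd⟩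
  have hy : y ∈ nextD M R := inl_mem_nextD _
  refine nextR_le_of_mem_nextD hM hR hp hR1 (x := ⁅x, y⁆)
    (commutator_mem_of_le_normalizer hn hxL hy)
    (Subgroup.commutator_le_right ⊤ _
      (Subgroup.commutator_mem_commutator (Subgroup.mem_top x) hy)) ?_ hn
  intro h
  refine hdk ?_
  -- Modulo `D'` the elements `x` and `x.right` act on `D` in the same way.
  obtain ⟨e, he1, he2⟩ := commutator_inl_inr ⟨d, hd⟩ x.right
  rw [← he1, ← mem_commutator_kernelD_iff hM hR hp hR1]
  rw [← Subgroup.mem_map_iff_mem (SemidirectProduct.inl_injective (φ := actD M R)), ← he2]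
  change _ ∈ nextR M R
  have hl : nextInr M R x.right = (nextInl x.left)⁻¹ * x := by
    rw [eq_inv_mul_iff_mul_eq, SemidirectProduct.inl_left_mul_inr_right]
  have hyx : y * x * y⁻¹ = x := by
    rw [mul_inv_eq_iff_eq_mul]
    exact (commutatorElement_eq_one_iff_mul_comm.mp h).symm
  rw [hl, nextR_eq]
  have : ⁅y, (nextInl x.left)⁻¹ * x⁆ =
      ⁅y, (nextInl x.left)⁻¹⁆ := by
    rw [commutatorElement_mul_right_eq_mul_conj]
    have : ⁅y, x⁆ = 1 := by rw [commutatorElement_def, hyx, mul_inv_cancel]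
    simp [this]
  rw [this]
  exact Subgroup.commutator_mem_commutator hy (inv_mem (inl_mem_nextD _))

end NextStep

/-! ### The finite groups of the tower -/

/-- The property propagated along the tower: `S.carrier` is a finite soluble group, and `S.R` is a
central subgroup of order `q` contained in every nontrivial normal subgroup. -/
structure Stage.HasCentralMonolith (S : Stage) (q : ℕ) : Prop where
  finite : Finite S.carrier
  solvable : Group.IsSolvable S.carrier
  le_of_normal : ∀ L : Subgroup S.carrier, L.Normal → L ≠ ⊥ → S.R ≤ L
  le_center : S.R ≤ Subgroup.center S.carrier
  card : Nat.card S.R = q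

namespace Stage.HasCentralMonolith

variable {S : Stage} {q : ℕ}

theorem ne_bot (hS : S.HasCentralMonolith q) (hq : q ≠ 1) : S.R ≠ ⊥ := by
  intro h
  have := hS.card
  rw [h, Subgroup.card_bot] at this
  exact hq this.symm

theorem minimal_iff (hS : S.HasCentralMonolith q) (hq : q ≠ 1) (N : Subgroup S.carrier) :
    Minimal (fun L : Subgroup S.carrier => L.Normal ∧ L ≠ ⊥) N ↔ N = S.R := by
  constructor
  · intro h
    exact (h.eq_of_le ⟨S.normal, hS.ne_bot hq⟩ (hS.le_of_normal N h.prop.1 h.prop.2)).symm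
  · rintro rfl
    exact ⟨⟨S.normal, hS.ne_bot hq⟩, fun L hL _ => hS.le_of_normal L hL.1 hL.2⟩

theorem next {p : ℕ} (hS : S.HasCentralMonolith q) (hq : q.Prime) (hp : p.Prime) (hpq : p ≠ q)
    {M : Type} [Group M] (hM : IsExtraspecial p M) : (S.next M).HasCentralMonolith p := by
  have := hS.finite
  have := hM.finite
  have := Fact.mk hp
  have hR : (Nat.card S.R).Coprime p := by
    rw [hS.card]
    exact (Nat.coprime_primes hq hp).mpr hpq.symm
  have hR1 := hS.ne_bot hq.ne_one
  refine ⟨?_, ?_, ?_, ?_, ?_⟩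
  · exact Finite.of_equiv _ (SemidirectProduct.equivProd (φ := actD M S.R)).symm
  · have := hS.solvable
    have : Group.IsSolvable (kernelD M S.R) :=
      have := (isPGroup_kernelD hM S.R).isNilpotent
      inferInstance
    exact Group.isSolvable_of_ker_le_range (nextInl : kernelD M S.R →* Next M S.R)
      (SemidirectProduct.rightHom : Next M S.R →* S.carrier) range_inl_eq_nextD.ge
  · intro L hL hL1
    obtain ⟨x, hx, hx1⟩ := L.bot_or_exists_ne_one.resolve_left hL1
    exact nextR_le_of_ne_one hM hR hp hR1 hS.le_of_normal hx hx1
      (le_top.trans (Subgroup.normalizer_eq_top_iff.mpr hL).ge)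
  · exact nextR_le_center hM hR hp hR1
  · exact card_nextR hM hR hp hR1

end Stage.HasCentralMonolith

namespace Input

variable (I : Input)

theorem hasCentralMonolith (i : ℕ) : (I.stage i).HasCentralMonolith (I.p i) := by
  induction i with
  | zero =>
    have := Fact.mk (I.prime 0)
    have hcard : Nat.card (Multiplicative (ZMod (I.p 0))) = I.p 0 := by
      rw [Nat.card_congr Multiplicative.toAdd, Nat.card_zmod]
    refine ⟨?_, ?_, ?_, ?_, ?_⟩
    · change Finite (Multiplicative (ZMod (I.p 0)))
      infer_instance
    · change Group.IsSolvable (Multiplicative (ZMod (I.p 0)))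
      infer_instance
    · intro L _ hL
      have : Fact (Nat.card (Multiplicative (ZMod (I.p 0)))).Prime := by
        rw [hcard]
        infer_instance
      exact le_of_eq ((Subgroup.eq_bot_or_eq_top_of_prime_card
        (G := Multiplicative (ZMod (I.p 0))) L).resolve_left hL).symm
    · exact (CommGroup.center_eq_top (G := Multiplicative (ZMod (I.p 0)))).ge
    · exact Subgroup.card_top.trans hcard
  | succ i ih => exact ih.next (I.prime i) (I.prime (i + 1)) (I.ne i) (I.extraspecial i)

/-- The subgroup `D_i` of `G_i`, with the convention `D_0 = G_0`. -/
def D : ∀ i, Subgroup (I.G i)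
  | 0 => (⊤ : Subgroup (I.G 0))
  | i + 1 => nextD (I.M (i + 1)) (I.R i)

instance (i : ℕ) : (I.D i).Normal := by
  cases i with
  | zero => exact (inferInstance : (⊤ : Subgroup (I.G 0)).Normal)
  | succ i => exact (inferInstance : (nextD (I.M (i + 1)) (I.R i)).Normal)

/-- The projection of `G_{i+1}` onto `G_i` with kernel `D_{i+1}`. -/
def proj (i : ℕ) : I.G (i + 1) →* I.G i :=
  (SemidirectProduct.rightHom : Next (I.M (i + 1)) (I.R i) →* I.G i)

theorem ker_proj (i : ℕ) : (I.proj i).ker = I.D (i + 1) := rfl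

@[simp]
theorem proj_embSucc (i : ℕ) (x : I.G i) : I.proj i (I.embSucc i x) = x :=
  SemidirectProduct.rightHom_inr x

theorem coprime_card_R (i : ℕ) : (Nat.card (I.R i)).Coprime (I.p (i + 1)) := by
  rw [(I.hasCentralMonolith i).card]
  exact (Nat.coprime_primes (I.prime _) (I.prime _)).mpr (I.ne i).symm

theorem R_ne_bot (i : ℕ) : I.R i ≠ ⊥ := (I.hasCentralMonolith i).ne_bot (I.prime i).ne_one

theorem R_le_D (i : ℕ) : I.R i ≤ I.D i := by
  cases i with
  | zero => exact le_top
  | succ i =>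
    change nextR (I.M (i + 1)) (I.R i) ≤ nextD (I.M (i + 1)) (I.R i)
    rw [nextR_eq]
    exact Subgroup.commutator_le_self _

theorem isPGroup_D (i : ℕ) : IsPGroup (I.p i) (I.D i) := by
  cases i with
  | zero =>
    have := Fact.mk (I.prime 0)
    exact IsPGroup.of_card (n := 1) (by
      rw [pow_one]; exact (I.hasCentralMonolith 0).card)
  | succ i =>
    have := (I.hasCentralMonolith i).finite
    exact isPGroup_nextD (I.extraspecial i)

theorem D_ne_bot (i : ℕ) : I.D i ≠ ⊥ := fun h => I.R_ne_bot i (le_bot_iff.mp (h ▸ I.R_le_D i))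

theorem D_succ_le {i : ℕ} {L : Subgroup (I.G (i + 1))} (hL : (I.R i).map (I.embSucc i) ≤ L)
    (hn : I.D (i + 1) ≤ Subgroup.normalizer (L : Set (I.G (i + 1)))) : I.D (i + 1) ≤ L := by
  have := (I.hasCentralMonolith i).finite
  exact nextD_le_of_map_inr_le (I.extraspecial i) (I.coprime_card_R i) hL hn

theorem R_succ_le {i : ℕ} {L : Subgroup (I.G (i + 1))} {x : I.G (i + 1)} (hxL : x ∈ L)
    (hx : x ≠ 1) (hn : I.D (i + 1) ≤ Subgroup.normalizer (L : Set (I.G (i + 1)))) :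
    I.R (i + 1) ≤ L := by
  have := (I.hasCentralMonolith i).finite
  exact nextR_le_of_ne_one (I.extraspecial i) (I.coprime_card_R i) (I.prime _) (I.R_ne_bot i)
    (I.hasCentralMonolith i).le_of_normal hxL hx hn

/-! ### The direct limit and its retractions onto the stages -/

/-- The canonical map of `G_i` to the direct limit. -/
noncomputable def ι (i : ℕ) : I.G i →* I.Limit where
  toFun x := ⟦⟨i, x⟩⟧
  map_one' := (DirectLimit.one_def i).symm
  map_mul' x y := (DirectLimit.mul_def i x y).symm

theorem ι_emb {i j : ℕ} (h : i ≤ j) (x : I.G i) : I.ι j (I.emb i j h x) = I.ι i x :=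
  DirectLimit.mk_apply i j x h

theorem ι_embSucc (i : ℕ) (x : I.G i) : I.ι (i + 1) (I.embSucc i x) = I.ι i x := by
  rw [← I.ι_emb i.le_succ, I.emb_succ i i le_rfl, emb_self]
  rfl

theorem exists_ι (j : ℕ) (x : I.Limit) : ∃ i, j ≤ i ∧ ∃ y, I.ι i y = x := by
  obtain ⟨i, y, rfl⟩ := DirectLimit.exists_eq_mk _ x
  exact ⟨max i j, le_max_right i j, I.emb i _ (le_max_left i j) y, I.ι_emb _ y⟩

/-- The retraction `G_j → G_i`, which is the inclusion if `j ≤ i` and kills `D_j, …, D_{i+1}` if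
`i < j`. -/
def retract (i : ℕ) : ∀ j, I.G j →* I.G i
  | 0 => I.emb 0 i i.zero_le
  | j + 1 => if h : j + 1 ≤ i then I.emb (j + 1) i h else (retract i j).comp (I.proj j)

theorem retract_of_le {i j : ℕ} (h : j ≤ i) : I.retract i j = I.emb j i h := by
  cases j with
  | zero => rfl
  | succ j => rw [retract, dif_pos h]

theorem retract_succ {i j : ℕ} (h : i ≤ j) :
    I.retract i (j + 1) = (I.retract i j).comp (I.proj j) := by
  rw [retract, dif_neg (by omega)]

theorem retract_embSucc (i j : ℕ) (x : I.G j) :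
    I.retract i (j + 1) (I.embSucc j x) = I.retract i j x := by
  rcases Nat.lt_or_ge j i with h | h
  · have h1 : I.emb j (j + 1) j.le_succ x = I.embSucc j x := by
      rw [I.emb_succ j j le_rfl, emb_self]
      rfl
    rw [I.retract_of_le h, I.retract_of_le h.le, ← h1]
    exact DirectedSystem.map_map (f := fun i j h => I.emb i j h) _ _ _
  · rw [I.retract_succ h, MonoidHom.comp_apply, proj_embSucc]

theorem retract_emb (i j k : ℕ) (h : j ≤ k) (x : I.G j) :
    I.retract i k (I.emb j k h x) = I.retract i j x := by
  induction k, h using Nat.le_induction with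
  | base => rw [emb_self]; rfl
  | succ k h ih => rw [I.emb_succ j k h, MonoidHom.comp_apply, retract_embSucc, ih]

/-- The retraction of the direct limit onto `G_i`. -/
noncomputable def ρ (i : ℕ) : I.Limit →* I.G i where
  toFun := DirectLimit.lift _ (fun j => I.retract i j) fun j k h x => (I.retract_emb i j k h x).symm
  map_one' := DirectLimit.lift_one (fun j => I.retract i j) _
  map_mul' := DirectLimit.lift_mul (fun j => I.retract i j) _

theorem ρ_ι (i j : ℕ) (x : I.G j) : I.ρ i (I.ι j x) = I.retract i j x := rfl

@[simp]
theorem ρ_ι_self (i : ℕ) (x : I.G i) : I.ρ i (I.ι i x) = x := by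
  rw [ρ_ι, I.retract_of_le le_rfl, emb_self]
  rfl

theorem proj_ρ (i : ℕ) (x : I.Limit) : I.proj i (I.ρ (i + 1) x) = I.ρ i x := by
  obtain ⟨j, hj, y, rfl⟩ := I.exists_ι (i + 1) x
  rw [ρ_ι, ρ_ι]
  induction j, hj using Nat.le_induction with
  | base =>
    rw [I.retract_of_le le_rfl, I.retract_succ le_rfl, I.retract_of_le le_rfl, emb_self, emb_self]
    rfl
  | succ j hj ih =>
    rw [I.retract_succ hj, I.retract_succ (i.le_succ.trans hj)]
    exact ih _

/-- The descending chain of normal subgroups of the limit: the whole group, followed by the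
kernels of the retractions onto `G_0, G_1, …`. -/
noncomputable def A : ℕ → Subgroup I.Limit
  | 0 => ⊤
  | i + 1 => (I.ρ i).ker

instance (i : ℕ) : (I.A i).Normal := by
  cases i <;> · unfold A; infer_instance

instance (i : ℕ) : (I.A i).FiniteIndex := by
  cases i with
  | zero => unfold A; infer_instance
  | succ i =>
    have := (I.hasCentralMonolith i).finite
    unfold A
    infer_instance

theorem A_anti : Antitone I.A := by
  refine antitone_nat_of_succ_le fun i => ?_
  cases i with
  | zero => exact le_top
  | succ i =>
    intro x hx
    have hx : I.ρ (i + 1) x = 1 := hx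
    change I.ρ i x = 1
    rw [← proj_ρ, hx, map_one]

theorem map_D_le_A {i j : ℕ} (h : i ≤ j) : (I.D j).map (I.ι j) ≤ I.A i := by
  refine le_trans ?_ (I.A_anti h)
  cases j with
  | zero => exact le_top
  | succ j =>
    rintro _ ⟨d, hd, rfl⟩
    change I.ρ j (I.ι (j + 1) d) = 1
    have hd : I.proj j d = 1 := hd
    rw [ρ_ι, I.retract_succ le_rfl, MonoidHom.comp_apply, hd, map_one]

theorem A_le_of_forall_map_D_le {i : ℕ} {N : Subgroup I.Limit}
    (h : ∀ j, i ≤ j → (I.D j).map (I.ι j) ≤ N) : I.A i ≤ N := by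
  intro x hx
  obtain ⟨j, hj, y, rfl⟩ := I.exists_ι i x
  induction j, hj using Nat.le_induction with
  | base =>
    refine h i le_rfl (Subgroup.mem_map_of_mem _ ?_)
    cases i with
    | zero => exact Subgroup.mem_top y
    | succ i =>
      have hx : I.ρ i (I.ι (i + 1) y) = 1 := hx
      rwa [← proj_ρ, ρ_ι_self] at hx
  | succ j hj ih =>
    have hd : y * (I.embSucc j (I.proj j y))⁻¹ ∈ I.D (j + 1) := by
      rw [← ker_proj, MonoidHom.mem_ker, map_mul, map_inv, proj_embSucc, mul_inv_cancel]
    have hd' := Subgroup.mem_map_of_mem (I.ι (j + 1)) hd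
    have e : I.ι (j + 1) y = I.ι (j + 1) (y * (I.embSucc j (I.proj j y))⁻¹) *
        I.ι j (I.proj j y) := by
      rw [← I.ι_embSucc j, ← map_mul, inv_mul_cancel_right]
    rw [e] at hx ⊢
    refine mul_mem (h _ (hj.trans j.le_succ) hd') (ih _ ?_)
    exact (Subgroup.mul_mem_cancel_left _ (I.map_D_le_A (hj.trans j.le_succ) hd')).mp hx

theorem not_A_le_succ (i : ℕ) : ¬ I.A i ≤ I.A (i + 1) := by
  intro h
  obtain ⟨d, hd, hd1⟩ := (I.D i).bot_or_exists_ne_one.resolve_left (I.D_ne_bot i)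
  have h1 : I.ρ i (I.ι i d) = 1 := h (I.map_D_le_A le_rfl (Subgroup.mem_map_of_mem _ hd))
  rw [ρ_ι_self] at h1
  exact hd1 h1

theorem exists_pow_mem_A_succ {i : ℕ} {x : I.Limit} (hx : x ∈ I.A i) :
    ∃ k, x ^ I.p i ^ k ∈ I.A (i + 1) := by
  have hD : I.ρ i x ∈ I.D i := by
    cases i with
    | zero => exact Subgroup.mem_top _
    | succ i =>
      have hx : I.ρ i x = 1 := hx
      rwa [← proj_ρ] at hx
  obtain ⟨k, hk⟩ := I.isPGroup_D i ⟨_, hD⟩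
  refine ⟨k, ?_⟩
  change I.ρ i _ = 1
  rw [map_pow]
  exact congrArg Subtype.val hk

/-! ### Subgroups of the limit -/

theorem le_normalizer_comap_ι {N : Subgroup I.Limit} {j : ℕ}
    (hn : (I.D j).map (I.ι j) ≤ Subgroup.normalizer (N : Set I.Limit)) :
    I.D j ≤ Subgroup.normalizer (N.comap (I.ι j) : Set (I.G j)) :=
  (Subgroup.map_le_iff_le_comap.mp hn).trans (Subgroup.le_normalizer_comap (I.ι j))

theorem map_D_succ_le {N : Subgroup I.Limit} {i : ℕ} (hR : (I.R i).map (I.ι i) ≤ N)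
    (hn : I.A (i + 1) ≤ Subgroup.normalizer (N : Set I.Limit)) :
    (I.D (i + 1)).map (I.ι (i + 1)) ≤ N := by
  rw [Subgroup.map_le_iff_le_comap]
  refine I.D_succ_le ?_ (I.le_normalizer_comap_ι ((I.map_D_le_A le_rfl).trans hn))
  rintro _ ⟨r, hr, rfl⟩
  change I.ι (i + 1) (I.embSucc i r) ∈ N
  rw [ι_embSucc]
  exact hR (Subgroup.mem_map_of_mem _ hr)

theorem map_R_succ_le {N : Subgroup I.Limit} {i : ℕ} {x : I.G (i + 1)} (hx : I.ι (i + 1) x ∈ N)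
    (hx1 : x ≠ 1) (hn : I.A (i + 1) ≤ Subgroup.normalizer (N : Set I.Limit)) :
    (I.R (i + 1)).map (I.ι (i + 1)) ≤ N := by
  rw [Subgroup.map_le_iff_le_comap]
  exact I.R_succ_le (show x ∈ N.comap (I.ι (i + 1)) from hx) hx1
    (I.le_normalizer_comap_ι ((I.map_D_le_A le_rfl).trans hn))

/-- A subgroup normalized by `A_i` and containing `R_i` contains `A_{i+1}`. -/
theorem A_succ_le_of_map_R_le {N : Subgroup I.Limit} {i : ℕ} (hR : (I.R i).map (I.ι i) ≤ N)
    (hn : I.A (i + 1) ≤ Subgroup.normalizer (N : Set I.Limit)) : I.A (i + 1) ≤ N := by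
  apply I.A_le_of_forall_map_D_le
  intro j hj
  induction j, hj using Nat.le_induction with
  | base => exact I.map_D_succ_le hR hn
  | succ j hj ih =>
    exact I.map_D_succ_le ((Subgroup.map_mono (I.R_le_D j)).trans ih)
      ((I.A_anti (by omega)).trans hn)

theorem A_le_of_map_D_le {N : Subgroup I.Limit} [N.Normal] {i : ℕ}
    (hD : (I.D i).map (I.ι i) ≤ N) : I.A i ≤ N := by
  have h := I.A_succ_le_of_map_R_le ((Subgroup.map_mono (I.R_le_D i)).trans hD)
    (by rw [Subgroup.normalizer_eq_top]; exact le_top)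
  apply I.A_le_of_forall_map_D_le
  intro j hj
  rcases hj.eq_or_lt with rfl | hj
  · exact hD
  · exact (I.map_D_le_A hj).trans h

/-- The key property behind hereditary just infiniteness: normality under a single `A_i` forces a
nontrivial subgroup to contain some `A_j`. -/
theorem exists_A_le {N : Subgroup I.Limit} (hN : N ≠ ⊥) {i : ℕ}
    (hn : I.A i ≤ Subgroup.normalizer (N : Set I.Limit)) : ∃ j, I.A j ≤ N := by
  obtain ⟨x, hx, hx1⟩ := N.bot_or_exists_ne_one.resolve_left hN
  obtain ⟨j, hj, y, rfl⟩ := I.exists_ι i x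
  have hy : I.embSucc j y ≠ 1 := fun h => hx1 (by rw [← ι_embSucc, h, map_one])
  have hR := I.map_R_succ_le (x := I.embSucc j y) (by rwa [ι_embSucc]) hy
    ((I.A_anti (by omega)).trans hn)
  exact ⟨j + 2, I.A_succ_le_of_map_R_le hR ((I.A_anti (by omega)).trans hn)⟩

theorem infinite_limit : Infinite I.Limit := by
  have h : StrictAnti I.A := strictAnti_nat_of_succ_lt fun i =>
    lt_of_le_not_ge (I.A_anti i.le_succ) (I.not_A_le_succ i)
  by_contra hfin
  rw [not_infinite_iff_finite] at hfin
  exact not_injective_infinite_finite I.A h.injective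

theorem exists_A_le_of_finiteIndex (H : Subgroup I.Limit) [H.FiniteIndex] : ∃ i, I.A i ≤ H := by
  have := I.infinite_limit
  have hne : H.normalCore ≠ ⊥ := by
    intro h
    have h1 : H.normalCore.FiniteIndex := inferInstance
    rw [h] at h1
    have h2 := h1.index_ne_zero
    rw [Subgroup.index_bot] at h2
    exact h2 Nat.card_eq_zero_of_infinite
  obtain ⟨i, hi⟩ := I.exists_A_le hne (i := 0)
    (by rw [Subgroup.normalizer_eq_top]; exact le_top)
  exact ⟨i, hi.trans H.normalCore_le⟩

theorem isHereditarilyJustInfinite_limit : IsHereditarilyJustInfinite I.Limit := by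
  have hinf := I.infinite_limit
  refine ⟨hinf, fun H hH => ⟨?_, fun N hN hN1 => ?_⟩⟩
  · by_contra h
    rw [not_infinite_iff_finite] at h
    have h1 := H.card_mul_index
    rw [Nat.card_eq_zero_of_infinite (α := I.Limit)] at h1
    exact (Nat.mul_ne_zero Nat.card_pos.ne' hH.index_ne_zero) h1
  · obtain ⟨i, hi⟩ := I.exists_A_le_of_finiteIndex H
    have hn : H ≤ Subgroup.normalizer (N.map H.subtype : Set I.Limit) := by
      have := Subgroup.le_normalizer_map (H := N) H.subtype
      rw [Subgroup.normalizer_eq_top, ← MonoidHom.range_eq_map, Subgroup.range_subtype] at this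
      exact this
    obtain ⟨j, hj⟩ := I.exists_A_le (N := N.map H.subtype)
      (by rwa [Ne, Subgroup.map_eq_bot_iff_of_injective _ H.subtype_injective]) (hi.trans hn)
    have h1 : (N.map H.subtype).FiniteIndex := Subgroup.finiteIndex_of_le hj
    have h2 : N.index ≠ 0 := by
      have h3 := h1.index_ne_zero
      rw [Subgroup.index_map_subtype] at h3
      exact left_ne_zero_of_mul h3
    have : N.FiniteIndex := ⟨h2⟩
    exact inferInstance

theorem residuallyFinite_limit : Group.ResiduallyFinite I.Limit := by
  rw [Group.residuallyFinite_iff_exists_finiteIndex]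
  intro x hx
  obtain ⟨i, -, y, rfl⟩ := I.exists_ι 0 x
  refine ⟨I.A (i + 1), inferInstance, fun h => hx ?_⟩
  have h : I.ρ i (I.ι i y) = 1 := h
  rw [ρ_ι_self] at h
  rw [h, map_one]

theorem isMulTorsion_limit : IsMulTorsion I.Limit := by
  intro x
  obtain ⟨i, -, y, rfl⟩ := I.exists_ι 0 x
  have := (I.hasCentralMonolith i).finite
  exact (I.ι i).isOfFinOrder (isOfFinOrder_of_finite y)

theorem isLocallySoluble_limit : IsLocallySoluble I.Limit := by
  rintro H ⟨S, rfl⟩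
  have h : ∃ i, (S : Set I.Limit) ⊆ (I.ι i).range := by
    classical
    induction S using Finset.induction_on with
    | empty => exact ⟨0, by simp⟩
    | insert x S _ ih =>
      obtain ⟨i, hi⟩ := ih
      obtain ⟨j, hj, y, rfl⟩ := I.exists_ι i x
      refine ⟨j, ?_⟩
      rw [Finset.coe_insert, Set.insert_subset_iff]
      refine ⟨⟨y, rfl⟩, hi.trans ?_⟩
      rintro _ ⟨z, rfl⟩
      exact ⟨I.emb i j hj z, I.ι_emb hj z⟩
  obtain ⟨i, hi⟩ := h
  have := (I.hasCentralMonolith i).solvable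
  have hr : Group.IsSolvable (I.ι i).range :=
    Group.isSolvable_of_surjective (I.ι i).rangeRestrict_surjective
  exact Group.isSolvable_of_isSolvable_injective
    (Subgroup.inclusion_injective ((Subgroup.closure_le _).mpr hi))

/-! ### The sequence of primes is an invariant -/

theorem map_D_le_of_forall_pow_mem {N : Subgroup I.Limit} [N.Normal] {i r : ℕ}
    (hr : (I.p i).Coprime r)
    (h : ∀ x ∈ (I.D i).map (I.ι i), ∃ k, x ^ r ^ k ∈ N) : (I.D i).map (I.ι i) ≤ N := by
  intro x hx
  obtain ⟨k, hk⟩ := h x hx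
  obtain ⟨d, hd, rfl⟩ := hx
  obtain ⟨n, hn⟩ := I.isPGroup_D i ⟨d, hd⟩
  have h1 : (I.ι i d : I.Limit ⧸ N) ^ I.p i ^ n = 1 := by
    rw [← QuotientGroup.mk_pow, ← map_pow,
      show d ^ I.p i ^ n = 1 from congrArg Subtype.val hn, map_one, QuotientGroup.mk_one]
  have h2 : (I.ι i d : I.Limit ⧸ N) ^ r ^ k = 1 := (QuotientGroup.eq_one_iff _).mpr hk
  exact (QuotientGroup.eq_one_iff _).mp (orderOf_eq_one_iff.mp (Nat.eq_one_of_dvd_coprimes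
    (hr.pow n k) (orderOf_dvd_of_pow_eq_one h1) (orderOf_dvd_of_pow_eq_one h2)))

/-- If the image of `A_i` in the quotient of the limit by a normal subgroup `N` is an `r`-group,
then either `N` contains `A_i`, or `r = p_i` and `N` contains `A_{i+1}`. -/
theorem A_le_or {N : Subgroup I.Limit} [N.Normal] {i r : ℕ} (hr : r.Prime)
    (h : ∀ x ∈ I.A i, ∃ k, x ^ r ^ k ∈ N) : I.A i ≤ N ∨ r = I.p i ∧ I.A (i + 1) ≤ N := by
  by_cases hri : r = I.p i
  · refine Or.inr ⟨hri, I.A_le_of_map_D_le (I.map_D_le_of_forall_pow_mem (r := r) ?_ ?_)⟩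
    · rw [hri]
      exact (Nat.coprime_primes (I.prime _) (I.prime _)).mpr (I.ne i)
    · exact fun x hx => h x (I.map_D_le_A i.le_succ hx)
  · refine Or.inl (I.A_le_of_map_D_le (I.map_D_le_of_forall_pow_mem (r := r) ?_ ?_))
    · exact (Nat.coprime_primes (I.prime _) hr).mpr (Ne.symm hri)
    · exact fun x hx => h x (I.map_D_le_A le_rfl hx)

variable {I} {J : Input}

theorem p_eq_and_A_succ_le (e : I.Limit ≃* J.Limit) {i : ℕ}
    (h : (J.A i).comap e.toMonoidHom = I.A i) :
    J.p i = I.p i ∧ I.A (i + 1) ≤ (J.A (i + 1)).comap e.toMonoidHom := by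
  refine (I.A_le_or (J.prime i) fun x hx => ?_).resolve_left fun hle => ?_
  · rw [← h] at hx
    obtain ⟨k, hk⟩ := J.exists_pow_mem_A_succ hx
    exact ⟨k, by rw [Subgroup.mem_comap, map_pow]; exact hk⟩
  · rw [← h] at hle
    exact J.not_A_le_succ i ((Subgroup.comap_le_comap_of_surjective e.surjective).mp hle)

theorem comap_A_eq (e : I.Limit ≃* J.Limit) (i : ℕ) :
    (J.A i).comap e.toMonoidHom = I.A i := by
  induction i with
  | zero => rfl
  | succ i ih =>
    have h' : (I.A i).comap e.symm.toMonoidHom = J.A i := by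
      rw [← ih]
      ext x
      simp
    refine le_antisymm ?_ (p_eq_and_A_succ_le e ih).2
    intro x hx
    have := (p_eq_and_A_succ_le e.symm h').2 hx
    simpa using this

theorem p_eq_of_mulEquiv (e : I.Limit ≃* J.Limit) : I.p = J.p :=
  funext fun i => (p_eq_and_A_succ_le e (comap_A_eq e i)).1.symm

end Input

/-! ### Extra-special groups of order `p ^ 3` -/

/-- The Heisenberg group over `ℤ / n`, whose element `⟨x, y, z⟩` stands for the unitriangular
matrix with entries `x`, `y` beside the diagonal and `z` in the corner. -/
@[ext]
structure Heisenberg (n : ℕ) where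
  x : ZMod n
  y : ZMod n
  z : ZMod n

namespace Heisenberg

variable {n : ℕ}

instance : Mul (Heisenberg n) := ⟨fun a b => ⟨a.x + b.x, a.y + b.y, a.z + b.z + a.x * b.y⟩⟩
instance : One (Heisenberg n) := ⟨⟨0, 0, 0⟩⟩
instance : Inv (Heisenberg n) := ⟨fun a => ⟨-a.x, -a.y, -a.z + a.x * a.y⟩⟩

@[simp] theorem mul_x (a b : Heisenberg n) : (a * b).x = a.x + b.x := rfl
@[simp] theorem mul_y (a b : Heisenberg n) : (a * b).y = a.y + b.y := rfl
@[simp] theorem mul_z (a b : Heisenberg n) : (a * b).z = a.z + b.z + a.x * b.y := rfl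
@[simp] theorem one_x : (1 : Heisenberg n).x = 0 := rfl
@[simp] theorem one_y : (1 : Heisenberg n).y = 0 := rfl
@[simp] theorem one_z : (1 : Heisenberg n).z = 0 := rfl
@[simp] theorem inv_x (a : Heisenberg n) : a⁻¹.x = -a.x := rfl
@[simp] theorem inv_y (a : Heisenberg n) : a⁻¹.y = -a.y := rfl
@[simp] theorem inv_z (a : Heisenberg n) : a⁻¹.z = -a.z + a.x * a.y := rfl

instance : Group (Heisenberg n) where
  mul_assoc a b c := by ext <;> simp <;> ring
  one_mul a := by ext <;> simp
  mul_one a := by ext <;> simp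
  inv_mul_cancel a := by ext <;> simp

theorem card : Nat.card (Heisenberg n) = n ^ 3 := by
  let e : Heisenberg n ≃ ZMod n × ZMod n × ZMod n :=
    ⟨fun a => (a.x, a.y, a.z), fun a => ⟨a.1, a.2.1, a.2.2⟩, fun _ => rfl, fun _ => rfl⟩
  rw [Nat.card_congr e, Nat.card_prod, Nat.card_prod, Nat.card_zmod]
  ring

theorem mem_center_iff {a : Heisenberg n} : a ∈ Subgroup.center _ ↔ a.x = 0 ∧ a.y = 0 := by
  rw [Subgroup.mem_center_iff]
  constructor
  · intro h
    have h1 := congrArg z (h ⟨1, 0, 0⟩)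
    have h2 := congrArg z (h ⟨0, 1, 0⟩)
    simp at h1 h2
    exact ⟨h2, h1⟩
  · rintro ⟨h1, h2⟩ b
    ext <;> simp [h1, h2, add_comm]

theorem isExtraspecial {p : ℕ} (hp : p.Prime) : IsExtraspecial p (Heisenberg p) where
  finite := Nat.finite_of_card_ne_zero (by rw [card]; exact pow_ne_zero _ hp.ne_zero)
  isPGroup := by
    have := Fact.mk hp
    exact IsPGroup.of_card card
  commutator_eq_center := by
    apply le_antisymm
    · rw [commutator_def, Subgroup.commutator_le]
      intro a _ b _
      rw [mem_center_iff]
      simp [commutatorElement_def]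
    · intro a ha
      rw [mem_center_iff] at ha
      have h : a = ⁅(⟨1, 0, 0⟩ : Heisenberg p), (⟨0, a.z, 0⟩ : Heisenberg p)⁆ := by
        ext <;> simp [commutatorElement_def, ha]
      rw [h, commutator_def]
      exact Subgroup.commutator_mem_commutator (Subgroup.mem_top _) (Subgroup.mem_top _)
  card_center := by
    let e : Subgroup.center (Heisenberg p) ≃ ZMod p :=
      ⟨fun a => a.1.z, fun c => ⟨⟨0, 0, c⟩, mem_center_iff.mpr ⟨rfl, rfl⟩⟩, fun a =>
        Subtype.ext (Heisenberg.ext (mem_center_iff.mp a.2).1.symm (mem_center_iff.mp a.2).2.symm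
          rfl), fun _ => rfl⟩
    rw [Nat.card_congr e, Nat.card_zmod]

end Heisenberg

/-! ### Uncountably many limits -/

/-- The input with Heisenberg groups for a sequence of primes that alternates between a choice of
`2` or `3` and the prime `5`. -/
def Input.ofChoice (s : ℕ → Bool) : Input :=
  have prime : ∀ i, (if Even i then (if s i then 2 else 3) else 5 : ℕ).Prime := by
    intro i
    split_ifs <;> norm_num
  { p := fun i => if Even i then (if s i then 2 else 3) else 5
    prime := prime
    ne := by
      intro i
      by_cases h : Even i
      · have h' : ¬ Even (i + 1) := by simpa [Nat.even_add_one] using h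
        simp only [h, h', if_true, if_false]
        split_ifs <;> norm_num
      · have h' : Even (i + 1) := by simpa [Nat.even_add_one] using h
        simp only [h, h', if_true, if_false]
        split_ifs <;> norm_num
    M := fun i => Heisenberg (if Even i then (if s i then 2 else 3) else 5)
    extraspecial := fun i => Heisenberg.isExtraspecial (prime (i + 1))
    card := fun i => Heisenberg.card }

/-- Cantor's diagonal argument for the limits of the inputs `Input.ofChoice s`. -/
theorem exists_input_forall_isEmpty (E : ℕ → Type) [∀ n, Group (E n)] :
    ∃ I : Input, ∀ n, IsEmpty (I.Limit ≃* E n) := by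
  classical
  -- At place `2 n` the choice differs from that of every input whose limit is `E n`.
  let s : ℕ → Bool := fun i =>
    decide (∀ n, 2 * n = i → ¬ ∃ I : Input, Nonempty (I.Limit ≃* E n) ∧ I.p i = 2)
  refine ⟨Input.ofChoice s, fun n => ⟨fun e => ?_⟩⟩
  have hp : (Input.ofChoice s).p (2 * n) = if s (2 * n) then 2 else 3 :=
    if_pos (even_two_mul n)
  by_cases h : ∃ I : Input, Nonempty (I.Limit ≃* E n) ∧ I.p (2 * n) = 2
  · have hs : s (2 * n) = false := by
      rw [decide_eq_false_iff_not]
      exact fun h' => h' n rfl h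
    obtain ⟨I, ⟨f⟩, hI⟩ := h
    have := congrFun (Input.p_eq_of_mulEquiv (e.trans f.symm)) (2 * n)
    rw [hp, hI, hs] at this
    simp at this
  · have hs : s (2 * n) = true := by
      rw [decide_eq_true_iff]
      intro m hm
      rwa [show m = n by omega]
    exact h ⟨_, ⟨e⟩, by rw [hp, hs]; rfl⟩

end WreathTower

open WreathTower in
theorem theorem2p7 :
    (∀ I : Input,
      (∀ i, Finite (I.G i) ∧ Group.IsSolvable (I.G i) ∧
        (∀ N : Subgroup (I.G i),
          Minimal (fun L : Subgroup (I.G i) => L.Normal ∧ L ≠ ⊥) N ↔ N = I.R i) ∧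
        I.R i ≤ Subgroup.center (I.G i) ∧ Nat.card (I.R i) = I.p i) ∧
      IsHereditarilyJustInfinite I.Limit ∧
      Group.ResiduallyFinite I.Limit ∧
      IsMulTorsion I.Limit ∧
      IsLocallySoluble I.Limit) ∧
    (∀ I J : Input, Nonempty (I.Limit ≃* J.Limit) → I.p = J.p) ∧
    (∀ (E : ℕ → Type) [∀ n, Group (E n)], ∃ I : Input, ∀ n, IsEmpty (I.Limit ≃* E n)) := by
  refine ⟨fun I => ⟨fun i => ?_, I.isHereditarilyJustInfinite_limit, I.residuallyFinite_limit,
    I.isMulTorsion_limit, I.isLocallySoluble_limit⟩,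
    fun I J ⟨e⟩ => Input.p_eq_of_mulEquiv e, fun E _ => exists_input_forall_isEmpty E⟩
  have h := I.hasCentralMonolith i
  exact ⟨h.finite, h.solvable, h.minimal_iff (I.prime i).ne_one, h.le_center, h.card⟩
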